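/- **Unique Path Lemma.** Let $P\subset\mathbb R^2$ be a finite set of points. A circle, regarded as the open disc of positive radius that it bounds, is *empty* if it contains no point of $P$, and it is a *maximal empty circle* (MEC) if moreover it is not contained in any other empty circle. The Voronoi diagram of $P$ is the set of points of the plane having at least two nearest points in $P$. Let $C$ and $C'$ be two distinct MECs of $P$, centred at $c$ and $c'$, that overlap within the convex hull of $P$, i.e. $C\cap C'\cap\operatorname{conv}(P)\neq\emptyset$. Then there is a unique simple path from $c$ to $c'$ contained in the Voronoi diagram of $P$ (unique as a subset of the plane, i.e. up to reparametrization) such that every MEC centred at a point of the path contains $C\cap C'$. -/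

import Mathlib

/-- The Euclidean plane. -/
abbrev Plane : Type := EuclideanSpace ℝ (Fin 2)

/-- The circle with centre `c` and radius `r`, regarded as the open disc it bounds, is empty:
it has positive radius and no point of `P` lies inside it. Points of `P` may lie on its
boundary. -/
def IsEmptyCircle (P : Set Plane) (c : Plane) (r : ℝ) : Prop :=
  0 < r ∧ Disjoint (Metric.ball c r) P

/-- A maximal empty circle: an empty circle not contained in any other empty circle. -/
def IsMEC (P : Set Plane) (c : Plane) (r : ℝ) : Prop :=
  IsEmptyCircle P c r ∧
    ∀ (c' : Plane) (r' : ℝ), IsEmptyCircle P c' r' →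
      Metric.ball c r ⊆ Metric.ball c' r' → c' = c ∧ r' = r

/-- The Voronoi diagram of `P` (the union of its vertices and edges): the points of the plane
that have at least two nearest points in `P`. -/
def voronoiDiagram (P : Set Plane) : Set Plane :=
  {x | ∃ p ∈ P, ∃ q ∈ P, p ≠ q ∧ dist x p = dist x q ∧ ∀ s ∈ P, dist x p ≤ dist x s}

/-- `A` is the trace of a simple path from `x` to `y`. Simple paths are identified with their
traces, so that reparametrizations of a path are not counted as different paths. -/
def IsSimplePath (A : Set Plane) (x y : Plane) : Prop :=
  ∃ γ : Path x y, Function.Injective γ ∧ Set.range γ = A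

/-! MECs are centred exactly at the points of the Voronoi diagram (`isMEC_of_two_nearest`,
`IsMEC.exists_two_nearest`). Such a disc contains `w` iff its centre is closer to `w` than to every
site, i.e. lies in the convex set `openCell P w`.

Existence: the segment from `c` to `c'` stays in the cells of all `w` in the overlap. Each of its
points is pushed away from a nearest site until it reaches the diagram; its empty disc only grows,
and a point `z` of the overlap in the hull prevents escape to infinity (`exists_radial_projection`).
The resulting path is made simple by `arcJoined_of_path`.

Uniqueness: the diagram inside `openCell P z` has no loops. If `p`, `q` are nearest to `x`, the disc
of any other such point meets the circle about `x` on exactly one side of the chord `p q`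
(`mem_leftSide_or`, `crossing_chords`), so a connected set avoiding `x` keeps to one side. If one
path passes through `x` and another avoids it, both branches of the first at `x` lie on the same
side; for `p`, `q` taken from one branch, the diagram near `x` on that side lies on a single ray,
against injectivity. -/

open Filter Topology

/-! ### Squared distances -/

/-- Squared Euclidean distance in coordinates. -/
def sqDist (a b : Plane) : ℝ := (a 0 - b 0) ^ 2 + (a 1 - b 1) ^ 2

lemma dist_eq_sqrt_sqDist (a b : Plane) : dist a b = √(sqDist a b) := by
  simp [EuclideanSpace.dist_eq, Fin.sum_univ_two, Real.dist_eq, sq_abs, sqDist]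

lemma sqDist_nonneg (a b : Plane) : 0 ≤ sqDist a b := by
  unfold sqDist; positivity

lemma dist_lt_dist_iff {a b c d : Plane} : dist a b < dist c d ↔ sqDist a b < sqDist c d := by
  rw [dist_eq_sqrt_sqDist, dist_eq_sqrt_sqDist, Real.sqrt_lt_sqrt_iff (sqDist_nonneg _ _)]

lemma dist_le_dist_iff {a b c d : Plane} : dist a b ≤ dist c d ↔ sqDist a b ≤ sqDist c d := by
  rw [dist_eq_sqrt_sqDist, dist_eq_sqrt_sqDist, Real.sqrt_le_sqrt_iff (sqDist_nonneg _ _)]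

lemma dist_eq_dist_iff {a b c d : Plane} : dist a b = dist c d ↔ sqDist a b = sqDist c d := by
  simp only [le_antisymm_iff, dist_le_dist_iff]

lemma plane_ext {a b : Plane} (h0 : a 0 = b 0) (h1 : a 1 = b 1) : a = b := by
  ext i; fin_cases i <;> simpa

lemma sqDist_pos {a b : Plane} (h : a ≠ b) : 0 < sqDist a b := by
  have := dist_pos.2 h
  rwa [dist_eq_sqrt_sqDist, Real.sqrt_pos] at this

/-! ### Nearest sites and cells -/

/-- `p` is a nearest point of `P` to `x`. -/
def IsNearest (P : Set Plane) (x p : Plane) : Prop := p ∈ P ∧ ∀ s ∈ P, dist x p ≤ dist x s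

/-- The open Voronoi cell of `w` with respect to the sites `P`. -/
def openCell (P : Set Plane) (w : Plane) : Set Plane := {y | ∀ s ∈ P, dist y w < dist y s}

variable {P : Set Plane}

lemma mem_voronoiDiagram_iff {x : Plane} :
    x ∈ voronoiDiagram P ↔ ∃ p q, IsNearest P x p ∧ IsNearest P x q ∧ p ≠ q := by
  constructor
  · rintro ⟨p, hp, q, hq, hpq, h, hmin⟩
    exact ⟨p, q, ⟨hp, hmin⟩, ⟨hq, fun s hs => h ▸ hmin s hs⟩, hpq⟩
  · rintro ⟨p, q, hp, hq, hpq⟩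
    exact ⟨p, hp.1, q, hq.1, hpq, le_antisymm (hp.2 q hq.1) (hq.2 p hp.1), hp.2⟩

lemma IsNearest.dist_eq {x p q : Plane} (hp : IsNearest P x p) (hq : IsNearest P x q) :
    dist x p = dist x q := le_antisymm (hp.2 q hq.1) (hq.2 p hp.1)

lemma exists_isNearest (hP : P.Finite) (hne : P.Nonempty) (x : Plane) :
    ∃ p, IsNearest P x p := by
  obtain ⟨p, hp, h⟩ := Set.exists_min_image P (fun s => dist x s) hP hne
  exact ⟨p, hp, h⟩

lemma isOpen_openCell (hP : P.Finite) (w : Plane) : IsOpen (openCell P w) := by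
  have : openCell P w = ⋂ s ∈ P, {y | dist y w < dist y s} := by
    ext y; simp [openCell]
  rw [this]
  exact hP.isOpen_biInter fun s _ => isOpen_lt (by fun_prop) (by fun_prop)

lemma convex_openCell (w : Plane) : Convex ℝ (openCell P w) := by
  intro a ha b hb s t hs ht hst p hp
  have h1 := dist_lt_dist_iff.1 (ha p hp)
  have h2 := dist_lt_dist_iff.1 (hb p hp)
  rw [dist_lt_dist_iff]
  simp only [sqDist, PiLp.add_apply, PiLp.smul_apply, smul_eq_mul] at *
  obtain rfl : t = 1 - s := by linarith
  rcases hs.eq_or_lt with rfl | hs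
  · simpa using h2
  · nlinarith [mul_lt_mul_of_pos_left h1 hs, mul_le_mul_of_nonneg_left h2.le ht]

lemma eventually_isNearest (hP : P.Finite) (x : Plane) :
    ∀ᶠ y in 𝓝 x, ∀ p, IsNearest P y p → IsNearest P x p := by
  have : ∀ p ∈ P, ∀ᶠ y in 𝓝 x, IsNearest P y p → IsNearest P x p := by
    intro p hp
    by_cases h : IsNearest P x p
    · exact Eventually.of_forall fun _ _ => h
    · obtain ⟨s, hs, hlt⟩ : ∃ s ∈ P, dist x s < dist x p := by
        by_contra! hcon
        exact h ⟨hp, hcon⟩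
      have : ∀ᶠ y in 𝓝 x, dist y s < dist y p :=
        (isOpen_lt (f := fun y => dist y s) (by fun_prop) (by fun_prop)).mem_nhds hlt
      filter_upwards [this] with y hy hyp
      exact absurd (hyp.2 s hs) (not_le.2 hy)
  filter_upwards [(eventually_all_finite hP).2 this] with y hy p hp
  exact hy p hp.1 hp

/-- Being nearest to a fixed site is a convex condition, so two nearest sites shared by both ends
persist along the segment. With `eventually_isNearest` this makes the diagram locally star-shaped.
-/
lemma segment_subset_voronoiDiagram {x y : Plane} (hy : y ∈ voronoiDiagram P)
    (h : ∀ p, IsNearest P y p → IsNearest P x p) : segment ℝ x y ⊆ voronoiDiagram P := by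
  obtain ⟨p, q, hp, hq, hpq⟩ := mem_voronoiDiagram_iff.1 hy
  have key : ∀ w, IsNearest P y w → ∀ m ∈ segment ℝ x y, IsNearest P m w := by
    rintro w hw m ⟨s, t, hs, ht, hst, rfl⟩
    refine ⟨hw.1, fun v hv => ?_⟩
    have h1 := dist_le_dist_iff.1 (hw.2 v hv)
    have h2 := dist_le_dist_iff.1 ((h w hw).2 v hv)
    rw [dist_le_dist_iff]
    simp only [sqDist, PiLp.add_apply, PiLp.smul_apply, smul_eq_mul] at *
    obtain rfl : t = 1 - s := by linarith
    nlinarith [mul_le_mul_of_nonneg_left h2 hs, mul_le_mul_of_nonneg_left h1 ht]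
  intro m hm
  exact mem_voronoiDiagram_iff.2 ⟨p, q, key p hp m hm, key q hq m hm, hpq⟩

/-! ### Maximal empty circles and the diagram -/

lemma IsNearest.isEmptyCircle {x p : Plane} (hp : IsNearest P x p) (hpos : 0 < dist x p) :
    IsEmptyCircle P x (dist x p) := by
  refine ⟨hpos, Set.disjoint_left.2 fun s hs hsP => ?_⟩
  rw [Metric.mem_ball, dist_comm] at hs
  exact absurd (hp.2 s hsP) (not_le.2 hs)

lemma dist_pos_of_two_nearest {x p q : Plane} (hp : IsNearest P x p) (hq : IsNearest P x q)
    (hpq : p ≠ q) : 0 < dist x p := by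
  refine dist_pos.2 fun h => hpq ?_
  have := hp.dist_eq hq
  rw [h, dist_self] at this
  exact dist_eq_zero.1 this.symm

/-- A containing disc with another centre leaves at most one point of the bounding circle outside
it, so it cannot avoid both `p` and `q`. -/
lemma isMEC_of_two_nearest {x p q : Plane} (hp : IsNearest P x p) (hq : IsNearest P x q)
    (hpq : p ≠ q) : IsMEC P x (dist x p) := by
  have hpos := dist_pos_of_two_nearest hp hq hpq
  refine ⟨hp.isEmptyCircle hpos, fun c r hcr hsub => ?_⟩
  have hcl : Metric.closedBall x (dist x p) ⊆ Metric.closedBall c r := by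
    rw [← closure_ball x hpos.ne', ← closure_ball c hcr.1.ne']
    exact closure_mono hsub
  have hout : ∀ s ∈ P, r ≤ dist s c := fun s hs => by
    by_contra! h
    exact Set.disjoint_left.1 hcr.2 (Metric.mem_ball.2 h) hs
  have hc : c = x := by
    by_contra hne
    have hv : 0 < ‖c - x‖ := norm_pos_iff.2 (sub_ne_zero.2 hne)
    set v := ‖c - x‖ with hvdef
    set R := dist x p with hR
    have hfar : R + v ≤ r := by
      -- The point of the closed disc farthest from `c`.
      have hm : x - (R / v) • (c - x) ∈ Metric.closedBall x R := by
        rw [Metric.mem_closedBall, dist_eq_norm]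
        simp only [sub_sub_cancel_left, norm_neg, norm_smul, Real.norm_eq_abs, abs_div]
        rw [← hvdef, abs_of_pos hv, abs_of_pos hpos, div_mul_cancel₀ _ hv.ne']
      have := Metric.mem_closedBall.1 (hcl hm)
      rw [dist_eq_norm] at this
      have e : x - (R / v) • (c - x) - c = (-(R / v + 1)) • (c - x) := by module
      rw [e, norm_smul, Real.norm_eq_abs, abs_neg, abs_of_pos (by positivity), ← hvdef] at this
      have e2 : (R / v + 1) * v = R + v := by field_simp
      linarith
    have huniq : ∀ s ∈ P, dist x s = R → s - x = -((R / v) • (c - x)) := by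
      intro s hs hsR
      have h1 : R + v ≤ ‖(s - x) - (c - x)‖ := by
        rw [sub_sub_sub_cancel_right, ← dist_eq_norm]
        exact hfar.trans (hout s hs)
      have h2 : ‖s - x‖ = R := by rw [← dist_eq_norm, dist_comm, hsR]
      have h3 := norm_sub_sq_real (s - x) (c - x)
      have h4 : (R + v) ^ 2 ≤ ‖(s - x) - (c - x)‖ ^ 2 := by gcongr
      rw [h3, h2, ← hvdef] at h4
      have h5 := norm_add_sq_real (s - x) ((R / v) • (c - x))
      rw [norm_smul, real_inner_smul_right, h2, Real.norm_eq_abs, abs_of_pos (by positivity),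
        ← hvdef, div_mul_cancel₀ _ hv.ne'] at h5
      have h6 : R / v * inner ℝ (s - x) (c - x) ≤ R / v * (-(R * v)) := by
        gcongr; nlinarith
      have h7 : R / v * (-(R * v)) = - R ^ 2 := by field_simp
      have h8 : ‖s - x + (R / v) • (c - x)‖ ^ 2 ≤ 0 := by rw [h5]; nlinarith
      have h9 : ‖s - x + (R / v) • (c - x)‖ = 0 := by
        have := sq_nonneg ‖s - x + (R / v) • (c - x)‖
        exact pow_eq_zero_iff two_ne_zero |>.1 (le_antisymm h8 this)
      exact eq_neg_of_add_eq_zero_left (norm_eq_zero.1 h9)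
    apply hpq
    have := (huniq p hp.1 rfl).trans (huniq q hq.1 (hp.dist_eq hq).symm).symm
    exact sub_left_injective this
  subst hc
  refine ⟨rfl, le_antisymm ?_ ?_⟩
  · rw [dist_comm]; exact hout p hp.1
  · have := hcl (Metric.mem_closedBall.2 (dist_comm p c).le)
    rwa [Metric.mem_closedBall, dist_comm] at this

/-- If `p` were the only nearest site, moving the centre slightly away from `p`, with `p` kept on
the boundary, would give a larger empty disc. -/
lemma IsMEC.exists_two_nearest (hP : P.Finite) {c : Plane} {r : ℝ} (h : IsMEC P c r) :
    ∃ p q, IsNearest P c p ∧ IsNearest P c q ∧ p ≠ q ∧ r = dist c p := by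
  obtain ⟨⟨hr, hdisj⟩, hmax⟩ := h
  have hne : P.Nonempty := by
    by_contra hP0
    rw [Set.not_nonempty_iff_eq_empty] at hP0
    have := (hmax c (r + 1) ⟨by linarith, by simp [hP0]⟩ (Metric.ball_subset_ball (by linarith))).2
    linarith
  obtain ⟨p, hp⟩ := exists_isNearest hP hne c
  have hrp : r ≤ dist c p := by
    by_contra! hlt
    exact Set.disjoint_left.1 hdisj (Metric.mem_ball'.2 hlt) hp.1
  have hreq : dist c p = r :=
    (hmax c _ (hp.isEmptyCircle (hr.trans_le hrp)) (Metric.ball_subset_ball hrp)).2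
  by_contra! hcon
  have hfar : ∀ s ∈ P, s ≠ p → r < dist c s := by
    intro s hs hsp
    rw [← hreq]
    refine lt_of_le_of_ne (hp.2 s hs) fun heq => ?_
    exact hcon p s hp ⟨hs, fun t ht => heq ▸ hp.2 t ht⟩ hsp.symm hreq.symm
  -- The factor `1 + 2 * ε` combines the new radius `(1 + ε) * r` with the shift `ε * r` of the
  -- centre.
  have hev : ∀ᶠ ε in 𝓝[>] (0 : ℝ), ∀ s ∈ P, s ≠ p → (1 + 2 * ε) * r < dist c s := by
    rw [eventually_all_finite hP]
    intro s hs
    by_cases hsp : s = p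
    · simp [hsp]
    · have : ∀ᶠ ε in 𝓝 (0 : ℝ), (1 + 2 * ε) * r < dist c s :=
        (isOpen_lt (f := fun ε : ℝ => (1 + 2 * ε) * r) (by fun_prop) (by fun_prop)).mem_nhds
          (by simpa using hfar s hs hsp)
      filter_upwards [this.filter_mono nhdsWithin_le_nhds] with ε hε _ using hε
  obtain ⟨ε, hε, hεpos⟩ := (hev.and self_mem_nhdsWithin).exists
  replace hεpos : 0 < ε := hεpos
  have hd : dist c (c + ε • (c - p)) = ε * r := by
    rw [dist_eq_norm, sub_add_cancel_left, norm_neg, norm_smul, ← dist_eq_norm, hreq,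
      Real.norm_eq_abs, abs_of_pos hεpos]
  have hdp : dist (c + ε • (c - p)) p = (1 + ε) * r := by
    have e : c + ε • (c - p) - p = (1 + ε) • (c - p) := by module
    rw [dist_eq_norm, e, norm_smul, ← dist_eq_norm, hreq, Real.norm_eq_abs,
      abs_of_pos (by linarith)]
  have hempty : IsEmptyCircle P (c + ε • (c - p)) ((1 + ε) * r) := by
    refine ⟨by positivity, Set.disjoint_left.2 fun s hs hsP => ?_⟩
    rw [Metric.mem_ball'] at hs
    by_cases hsp : s = p
    · rw [hsp, hdp] at hs; exact lt_irrefl _ hs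
    · have h1 := hε s hsP hsp
      have h2 := dist_triangle c (c + ε • (c - p)) s
      rw [hd] at h2
      nlinarith
  have := (hmax _ _ hempty (Metric.ball_subset_ball' (by rw [hd]; linarith))).1
  rw [this, dist_self] at hd
  have : 0 < ε * r := by positivity
  linarith

/-! ### The two sides of a chord -/

/-- Twice the signed area of the triangle `p q w`. -/
def signedArea (p q w : Plane) : ℝ := (q 0 - p 0) * (w 1 - p 1) - (q 1 - p 1) * (w 0 - p 0)

lemma signedArea_swap (p q w : Plane) : signedArea q p w = -signedArea p q w := by
  unfold signedArea; ring

lemma exists_affine_coordinate {p q : Plane} (hpq : p ≠ q) {a b : ℝ}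
    (h : (q 0 - p 0) * (b - p 1) - (q 1 - p 1) * (a - p 0) = 0) :
    ∃ μ : ℝ, a = p 0 + μ * (q 0 - p 0) ∧ b = p 1 + μ * (q 1 - p 1) := by
  have hpos := sqDist_pos hpq
  unfold sqDist at hpos
  refine ⟨((a - p 0) * (q 0 - p 0) + (b - p 1) * (q 1 - p 1)) /
    ((p 0 - q 0) ^ 2 + (p 1 - q 1) ^ 2), ?_, ?_⟩
  · field_simp
    linear_combination (p 1 - q 1) * h
  · field_simp
    linear_combination (q 0 - p 0) * h

/-- Chords of a circle whose end points separate each other cross, so a disc containing the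
ends of one of them cannot avoid the ends of the other. -/
lemma crossing_chords {x y p q u v : Plane} (hq : sqDist x q = sqDist x p)
    (hu : sqDist x u = sqDist x p) (hv : sqDist x v = sqDist x p)
    (hul : 0 < signedArea p q u) (hvr : signedArea p q v < 0)
    (hup : sqDist y u < sqDist y p) (huq : sqDist y u < sqDist y q)
    (hvp : sqDist y v ≤ sqDist y p) (hvq : sqDist y v ≤ sqDist y q) : False := by
  have hpq : p ≠ q := by
    rintro rfl
    simp [signedArea] at hul
  set a := -signedArea p q v with ha
  set b := signedArea p q u with hb
  have ha0 : 0 < a := by linarith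
  -- These weights locate the point where the chord `u v` meets the line `p q`.
  obtain ⟨l, hl0, hl1, hlab⟩ : ∃ l : ℝ, 0 < l ∧ l < 1 ∧ l * b = (1 - l) * a := by
    refine ⟨a / (a + b), by positivity, by rw [div_lt_one (by positivity)]; linarith, ?_⟩
    field_simp; ring
  obtain ⟨μ, h0, h1⟩ := exists_affine_coordinate hpq
    (a := l * u 0 + (1 - l) * v 0) (b := l * u 1 + (1 - l) * v 1) (by
      simp only [ha, hb, signedArea] at hlab
      linear_combination hlab)
  -- The power of the crossing point with respect to the circle about `x`, computed along both
  -- lines, shows that it lies between `p` and `q`.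
  have hin : 0 ≤ μ * (1 - μ) * sqDist p q := by
    have e1 : (x 0 - (l * u 0 + (1 - l) * v 0)) ^ 2 + (x 1 - (l * u 1 + (1 - l) * v 1)) ^ 2 =
        sqDist x p - l * (1 - l) * sqDist u v := by
      have : l * sqDist x u + (1 - l) * sqDist x v = sqDist x p := by rw [hu, hv]; ring
      rw [← this]; unfold sqDist; ring
    have e2 : (x 0 - (p 0 + μ * (q 0 - p 0))) ^ 2 + (x 1 - (p 1 + μ * (q 1 - p 1))) ^ 2 =
        sqDist x p - μ * (1 - μ) * sqDist p q := by
      have : (1 - μ) * sqDist x p + μ * sqDist x q = sqDist x p := by rw [hq]; ring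
      nth_rw 1 [← this]; unfold sqDist; ring
    rw [← h0, ← h1, e1] at e2
    have : 0 ≤ l * (1 - l) * sqDist u v :=
      mul_nonneg (mul_nonneg hl0.le (by linarith)) (sqDist_nonneg _ _)
    linarith
  have hμ : 0 ≤ μ * (1 - μ) := nonneg_of_mul_nonneg_left hin (sqDist_pos hpq)
  have hμ0 : 0 ≤ μ := by nlinarith
  have hμ1 : μ ≤ 1 := by nlinarith
  -- The difference of squared distances to `y` and to `x` is affine, so both chords give the same
  -- value at the crossing point.
  have hbal : l * (sqDist y u - sqDist x u) + (1 - l) * (sqDist y v - sqDist x v) =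
      (1 - μ) * (sqDist y p - sqDist x p) + μ * (sqDist y q - sqDist x q) := by
    unfold sqDist
    linear_combination (2 * (x 0 - y 0)) * h0 + (2 * (x 1 - y 1)) * h1
  rw [hu, hv, hq] at hbal
  rcases le_total (sqDist y p) (sqDist y q) with h | h
  · nlinarith [mul_lt_mul_of_pos_left hup hl0, mul_le_mul_of_nonneg_left hvp (by linarith : 0 ≤ 1 - l),
      mul_le_mul_of_nonneg_left h hμ0]
  · nlinarith [mul_lt_mul_of_pos_left huq hl0, mul_le_mul_of_nonneg_left hvq (by linarith : 0 ≤ 1 - l),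
      mul_le_mul_of_nonneg_left h (by linarith : 0 ≤ 1 - μ)]

/-- The points `y` whose maximal empty disc contains a point of the circle about `x` through `p`
on the left of the line `p q`. -/
def leftSide (P : Set Plane) (x p q : Plane) : Set Plane :=
  {y | ∃ u, sqDist x u = sqDist x p ∧ 0 < signedArea p q u ∧ y ∈ openCell P u}

lemma isOpen_leftSide (hP : P.Finite) (x p q : Plane) : IsOpen (leftSide P x p q) := by
  have : leftSide P x p q =
      ⋃ u ∈ {u | sqDist x u = sqDist x p ∧ 0 < signedArea p q u}, openCell P u := by
    ext y; simp [leftSide, and_assoc]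
  rw [this]
  exact isOpen_biUnion fun u _ => isOpen_openCell hP u

lemma disjoint_leftSide {x p q : Plane} (hp : IsNearest P x p) (hq : IsNearest P x q) :
    Disjoint (leftSide P x p q) (leftSide P x q p) := by
  rw [Set.disjoint_left]
  rintro y ⟨u, hu, hul, hyu⟩ ⟨v, hv, hvl, hyv⟩
  have hqp := dist_eq_dist_iff.1 (hq.dist_eq hp)
  rw [signedArea_swap] at hvl
  exact crossing_chords hqp hu (hv.trans hqp) hul (by linarith)
    (dist_lt_dist_iff.1 (hyu p hp.1)) (dist_lt_dist_iff.1 (hyu q hq.1))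
    (dist_lt_dist_iff.1 (hyv p hp.1)).le (dist_lt_dist_iff.1 (hyv q hq.1)).le

lemma eq_or_eq_of_signedArea_eq_zero {x p q u : Plane} (hpq : p ≠ q)
    (hq : sqDist x q = sqDist x p) (hu : sqDist x u = sqDist x p) (h : signedArea p q u = 0) :
    u = p ∨ u = q := by
  obtain ⟨μ, h0, h1⟩ := exists_affine_coordinate hpq h
  have e : μ * (1 - μ) * sqDist p q = 0 := by
    have : (1 - μ) * sqDist x p + μ * sqDist x q = sqDist x u := by rw [hq, hu]; ring
    unfold sqDist at *
    rw [h0, h1] at this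
    linear_combination this
  rcases mul_eq_zero.1 ((mul_eq_zero.1 e).resolve_right (sqDist_pos hpq).ne') with hμ | hμ
  · left; apply plane_ext <;> simp [h0, h1, hμ]
  · obtain rfl : μ = 1 := by linarith
    right; apply plane_ext <;> simp [h0, h1]

/-- The disc of `y` contains `z`, which is inside the disc of `x`, but by maximality is not
contained in that disc. It therefore contains a point of the circle about `x`, which is neither `p`
nor `q` since these are sites. -/
lemma mem_leftSide_or {x y z p q : Plane} (hp : IsNearest P x p) (hq : IsNearest P x q)
    (hpq : p ≠ q) (hy : y ∈ voronoiDiagram P) (hyx : y ≠ x) (hxz : x ∈ openCell P z)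
    (hyz : y ∈ openCell P z) : y ∈ leftSide P x p q ∪ leftSide P x q p := by
  obtain ⟨p', q', hp', hq', hpq'⟩ := mem_voronoiDiagram_iff.1 hy
  have hmec := isMEC_of_two_nearest hp' hq' hpq'
  have hnot : ¬ Metric.ball y (dist y p') ⊆ Metric.ball x (dist x p) := fun hsub =>
    hyx (hmec.2 _ _ (hp.isEmptyCircle (dist_pos_of_two_nearest hp hq hpq)) hsub).1.symm
  obtain ⟨w, hwy, hwx⟩ := Set.not_subset.1 hnot
  have hzy : z ∈ Metric.ball y (dist y p') := Metric.mem_ball'.2 (hyz p' hp'.1)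
  rw [Metric.mem_ball', not_lt] at hwx
  obtain ⟨u, huy, hux⟩ := (convex_ball y (dist y p')).isPreconnected.intermediate_value hzy hwy
    (f := fun w => dist x w) (by fun_prop) ⟨(hxz p hp.1).le, hwx⟩
  have hcell : y ∈ openCell P u := fun s hs => (Metric.mem_ball'.1 huy).trans_le (hp'.2 s hs)
  have hu := dist_eq_dist_iff.1 hux
  have hqp := dist_eq_dist_iff.1 (hq.dist_eq hp)
  rcases lt_trichotomy (signedArea p q u) 0 with h | h | h
  · exact Or.inr ⟨u, hu.trans hqp.symm, by rw [signedArea_swap]; linarith, hcell⟩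
  · rcases eq_or_eq_of_signedArea_eq_zero hpq hqp hu h with rfl | rfl
    · exact absurd (hcell u hp.1) (lt_irrefl _)
    · exact absurd (hcell u hq.1) (lt_irrefl _)
  · exact Or.inl ⟨u, hu, h, hcell⟩

/-! ### The diagram near a point, on one side of a chord -/

/-- The vector `q - p` turned by a right angle to the left. -/
noncomputable def leftNormal (p q : Plane) : Plane := !₂[-(q 1 - p 1), q 0 - p 0]

lemma exists_pos_smul_leftNormal {x y p q : Plane} (hpq : p ≠ q) (hp : IsNearest P x p)
    (hq : IsNearest P x q) (hyp : IsNearest P y p) (hyq : IsNearest P y q)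
    (hy : y ∈ leftSide P x p q) : ∃ κ : ℝ, 0 < κ ∧ y = x + κ • leftNormal p q := by
  obtain ⟨u, hu, hul, hyu⟩ := hy
  have h1 := dist_eq_dist_iff.1 (hq.dist_eq hp)
  have h2 := dist_eq_dist_iff.1 (hyq.dist_eq hyp)
  have h3 := dist_lt_dist_iff.1 (hyu p hp.1)
  have hpos := sqDist_pos hpq
  have horth : (y 0 - x 0) * (q 0 - p 0) + (y 1 - x 1) * (q 1 - p 1) = 0 := by
    unfold sqDist at h1 h2; linarith
  obtain ⟨κ, hκ0, hκ1⟩ : ∃ κ : ℝ, y 0 - x 0 = κ * (-(q 1 - p 1)) ∧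
      y 1 - x 1 = κ * (q 0 - p 0) := by
    unfold sqDist at hpos
    refine ⟨((y 1 - x 1) * (q 0 - p 0) - (y 0 - x 0) * (q 1 - p 1)) /
      ((p 0 - q 0) ^ 2 + (p 1 - q 1) ^ 2), ?_, ?_⟩
    · field_simp; linear_combination (q 0 - p 0) * horth
    · field_simp; linear_combination (q 1 - p 1) * horth
  refine ⟨κ, ?_, plane_ext ?_ ?_⟩
  · have : 0 < κ * signedArea p q u := by
      have e : κ * signedArea p q u =
          (y 0 - x 0) * (u 0 - p 0) + (y 1 - x 1) * (u 1 - p 1) := by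
        rw [hκ0, hκ1]; unfold signedArea; ring
      rw [e]
      unfold sqDist at hu h3
      linarith
    exact pos_of_mul_pos_left this hul.le
  · simp [leftNormal]; linarith
  · simp [leftNormal]; linarith

/-- A site `s` to the right is excluded by crossing chords in the disc of `y'`. A site to the left
would be closer to `y` than `p`, as `y` is displaced from `x` to the left. -/
lemma eq_or_eq_of_mem_leftSide {x y y' p q s : Plane} (hpq : p ≠ q) (hp : IsNearest P x p)
    (hq : IsNearest P x q) (hyp : IsNearest P y p) (hyq : IsNearest P y q)
    (hy : y ∈ leftSide P x p q) (hy' : y' ∈ leftSide P x p q) (hs : IsNearest P x s)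
    (hs' : IsNearest P y' s) : s = p ∨ s = q := by
  have hqp := dist_eq_dist_iff.1 (hq.dist_eq hp)
  have hsp := dist_eq_dist_iff.1 (hs.dist_eq hp)
  rcases lt_trichotomy (signedArea p q s) 0 with h | h | h
  · exfalso
    obtain ⟨u, hu, hul, hyu⟩ := hy'
    exact crossing_chords hqp hu hsp hul h
      (dist_lt_dist_iff.1 (hyu p hp.1)) (dist_lt_dist_iff.1 (hyu q hq.1))
      (dist_le_dist_iff.1 (hs'.2 p hp.1)) (dist_le_dist_iff.1 (hs'.2 q hq.1))
  · exact eq_or_eq_of_signedArea_eq_zero hpq hqp hsp h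
  · exfalso
    obtain ⟨κ, hκ, rfl⟩ := exists_pos_smul_leftNormal hpq hp hq hyp hyq hy
    have h1 := dist_le_dist_iff.1 (hyp.2 s hs.1)
    have h2 := mul_pos hκ h
    simp [leftNormal, sqDist, signedArea] at *
    nlinarith

lemma mem_ray_of_mem_leftSide {x y y' p q : Plane} (hpq : p ≠ q) (hp : IsNearest P x p)
    (hq : IsNearest P x q) (hyp : IsNearest P y p) (hyq : IsNearest P y q)
    (hy : y ∈ leftSide P x p q) (hy' : y' ∈ leftSide P x p q) (hV : y' ∈ voronoiDiagram P)
    (hnear : ∀ s, IsNearest P y' s → IsNearest P x s) :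
    ∃ κ : ℝ, 0 < κ ∧ y' = x + κ • leftNormal p q := by
  obtain ⟨s, t, hs, ht, hst⟩ := mem_voronoiDiagram_iff.1 hV
  have h1 := eq_or_eq_of_mem_leftSide hpq hp hq hyp hyq hy hy' (hnear s hs) hs
  have h2 := eq_or_eq_of_mem_leftSide hpq hp hq hyp hyq hy hy' (hnear t ht) ht
  rcases h1 with rfl | rfl <;> rcases h2 with rfl | rfl
  · exact absurd rfl hst
  · exact exists_pos_smul_leftNormal hpq hp hq hs ht hy'
  · exact exists_pos_smul_leftNormal hpq hp hq ht hs hy'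
  · exact absurd rfl hst

/-! ### Uniqueness -/

/-- Within the part of the Voronoi diagram lying in the cell of an additional site `z`, a simple
path is contained in every connected set that contains its end points. -/
lemma IsSimplePath.subset_of_isPreconnected (hP : P.Finite) {z c c' : Plane} {A B : Set Plane}
    (hA : IsSimplePath A c c') (hAV : A ⊆ voronoiDiagram P) (hAz : A ⊆ openCell P z)
    (hB : IsPreconnected B) (hBV : B ⊆ voronoiDiagram P) (hBz : B ⊆ openCell P z)
    (hc : c ∈ B) (hc' : c' ∈ B) : A ⊆ B := by
  obtain ⟨γ, hinj, rfl⟩ := hA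
  rintro x ⟨⟨s, hs⟩, hsx⟩
  by_contra hxB
  set f : ℝ → Plane := fun t => γ.extend t with hf
  have hfc : Continuous f := γ.continuous_extend
  have hfi : Set.InjOn f (Set.Icc 0 1) := by
    intro a ha b hb hab
    simp only [hf, Path.extend_apply γ ha, Path.extend_apply γ hb] at hab
    exact congrArg Subtype.val (hinj hab)
  have hfA : ∀ t, f t ∈ Set.range γ := fun t => by
    rw [← Path.extend_range]; exact ⟨t, rfl⟩
  have hfs : f s = x := by rw [← hsx]; exact Path.extend_apply γ hs
  have hf0 : f 0 = c := γ.extend_zero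
  have hf1 : f 1 = c' := γ.extend_one
  have hs0 : 0 < s := lt_of_le_of_ne hs.1 fun h => hxB (by rw [← hfs, ← h, hf0]; exact hc)
  have hs1 : s < 1 := lt_of_le_of_ne hs.2 fun h => hxB (by rw [← hfs, h, hf1]; exact hc')
  -- The path with `x` removed falls into two pieces, which `B` reconnects through `c` and `c'`.
  set G : Set Plane := f '' Set.Ico 0 s ∪ B ∪ f '' Set.Ioc s 1 with hG
  have hGconn : IsPreconnected G := by
    refine IsPreconnected.union c' (Or.inr hc') ⟨1, ⟨hs1, le_rfl⟩, hf1⟩ ?_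
      (isPreconnected_Ioc.image _ hfc.continuousOn)
    exact IsPreconnected.union c ⟨0, ⟨le_rfl, hs0⟩, hf0⟩ hc
      (isPreconnected_Ico.image _ hfc.continuousOn) hB
  have hxG : ∀ y ∈ G, y ≠ x := by
    rintro y ((⟨t, ht, rfl⟩ | hy) | ⟨t, ht, rfl⟩) h
    · exact ht.2.ne (hfi ⟨ht.1, ht.2.le.trans hs.2⟩ hs (h.trans hfs.symm))
    · exact hxB (h ▸ hy)
    · exact ht.1.ne' (hfi ⟨hs.1.trans ht.1.le, ht.2⟩ hs (h.trans hfs.symm))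
  have hGV : G ⊆ voronoiDiagram P := by
    rintro y ((⟨t, ht, rfl⟩ | hy) | ⟨t, ht, rfl⟩)
    exacts [hAV (hfA t), hBV hy, hAV (hfA t)]
  have hGz : G ⊆ openCell P z := by
    rintro y ((⟨t, ht, rfl⟩ | hy) | ⟨t, ht, rfl⟩)
    exacts [hAz (hfA t), hBz hy, hAz (hfA t)]
  have hxz : x ∈ openCell P z := hfs ▸ hAz (hfA s)
  have hev : ∀ᶠ t in 𝓝 s, ∀ p, IsNearest P (f t) p → IsNearest P x p := by
    have := hfc.tendsto s
    rw [hfs] at this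
    exact this.eventually (eventually_isNearest hP x)
  obtain ⟨ε, hε, hball⟩ := Metric.eventually_nhds_iff.1 hev
  obtain ⟨s₁, hs₁0, hs₁s, hs₁ε⟩ : ∃ s₁, 0 ≤ s₁ ∧ s₁ < s ∧ s - s₁ < ε :=
    ⟨max 0 (s - ε / 2), le_max_left _ _, max_lt hs0 (by linarith),
      by linarith [le_max_right 0 (s - ε / 2)]⟩
  obtain ⟨s₂, hs₂1, hs₂s, hs₂ε⟩ : ∃ s₂, s₂ ≤ 1 ∧ s < s₂ ∧ s₂ - s < ε :=
    ⟨min 1 (s + ε / 2), min_le_left _ _, lt_min hs1 (by linarith),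
      by linarith [min_le_right 1 (s + ε / 2)]⟩
  have hnear : ∀ t ∈ Set.Icc s₁ s₂, ∀ p, IsNearest P (f t) p → IsNearest P x p := by
    intro t ht
    refine hball ?_
    rw [Real.dist_eq, abs_lt]
    constructor <;> linarith [ht.1, ht.2]
  have hmemG : ∀ t ∈ Set.Icc s₁ s₂, t ≠ s → f t ∈ G := by
    intro t ht hts
    rcases lt_or_gt_of_ne hts with h | h
    · exact Or.inl (Or.inl ⟨t, ⟨hs₁0.trans ht.1, h⟩, rfl⟩)
    · exact Or.inr ⟨t, ⟨h, ht.2.trans hs₂1⟩, rfl⟩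
  have hs₁mem : s₁ ∈ Set.Icc s₁ s₂ := ⟨le_rfl, by linarith⟩
  have hs₂mem : s₂ ∈ Set.Icc s₁ s₂ := ⟨by linarith, le_rfl⟩
  have hy₁G := hmemG s₁ hs₁mem hs₁s.ne
  obtain ⟨p, q, hpq, hyp, hyq, hleft⟩ : ∃ p q, p ≠ q ∧ IsNearest P (f s₁) p ∧
      IsNearest P (f s₁) q ∧ f s₁ ∈ leftSide P x p q := by
    obtain ⟨p, q, hp, hq, hpq⟩ := mem_voronoiDiagram_iff.1 (hGV hy₁G)
    rcases mem_leftSide_or (hnear s₁ hs₁mem p hp) (hnear s₁ hs₁mem q hq) hpq (hGV hy₁G)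
      (hxG _ hy₁G) hxz (hGz hy₁G) with h | h
    · exact ⟨p, q, hpq, hp, hq, h⟩
    · exact ⟨q, p, hpq.symm, hq, hp, h⟩
  have hp := hnear s₁ hs₁mem p hyp
  have hq := hnear s₁ hs₁mem q hyq
  have hGleft : G ⊆ leftSide P x p q :=
    hGconn.subset_left_of_subset_union (isOpen_leftSide hP x p q) (isOpen_leftSide hP x q p)
      (disjoint_leftSide hp hq)
      (fun y hy => mem_leftSide_or hp hq hpq (hGV hy) (hxG y hy) hxz (hGz hy))
      ⟨f s₁, hy₁G, hleft⟩
  set n := leftNormal p q with hn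
  have hray : ∀ t ∈ Set.Icc s₁ s₂, t ≠ s → ∃ κ : ℝ, 0 < κ ∧ f t = x + κ • n := by
    intro t ht hts
    have := hmemG t ht hts
    exact mem_ray_of_mem_leftSide hpq hp hq hyp hyq hleft (hGleft this) (hGV this) (hnear t ht)
  have hn0 : 0 < inner ℝ n n := by
    rw [real_inner_self_pos]
    rintro h0
    obtain ⟨κ, -, hκ⟩ := hray s₁ hs₁mem hs₁s.ne
    exact hxG _ hy₁G (by rw [hκ, h0]; simp)
  -- The height along the ray vanishes at `s` and is positive on both sides, so a common height is
  -- attained before and after `s`.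
  set τ : ℝ → ℝ := fun t => inner ℝ (f t - x) n with hτ
  have hτc : Continuous τ := by fun_prop
  have hτs : τ s = 0 := by simp [hτ, hfs]
  have hτκ : ∀ t (κ : ℝ), f t = x + κ • n → τ t = κ * inner ℝ n n := by
    intro t κ h
    simp only [hτ, h, add_sub_cancel_left, real_inner_smul_left]
  have hτpos : ∀ t ∈ Set.Icc s₁ s₂, t ≠ s → 0 < τ t := by
    intro t ht hts
    obtain ⟨κ, hκ, h⟩ := hray t ht hts
    rw [hτκ t κ h]; positivity
  have h₁ := hτpos s₁ hs₁mem hs₁s.ne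
  have h₂ := hτpos s₂ hs₂mem hs₂s.ne'
  set v := min (τ s₁) (τ s₂) with hv
  have hv0 : 0 < v := lt_min h₁ h₂
  obtain ⟨t₁, ht₁, hvt₁⟩ := intermediate_value_Icc' hs₁s.le hτc.continuousOn
    (show v ∈ Set.Icc (τ s) (τ s₁) from ⟨hτs ▸ hv0.le, min_le_left _ _⟩)
  obtain ⟨t₂, ht₂, hvt₂⟩ := intermediate_value_Icc hs₂s.le hτc.continuousOn
    (show v ∈ Set.Icc (τ s) (τ s₂) from ⟨hτs ▸ hv0.le, min_le_right _ _⟩)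
  have hne₁ : t₁ ≠ s := by rintro rfl; linarith
  have hne₂ : t₂ ≠ s := by rintro rfl; linarith
  obtain ⟨κ₁, -, hκ₁⟩ := hray t₁ ⟨ht₁.1, ht₁.2.trans hs₂s.le⟩ hne₁
  obtain ⟨κ₂, -, hκ₂⟩ := hray t₂ ⟨hs₁s.le.trans ht₂.1, ht₂.2⟩ hne₂
  have hκ : κ₁ = κ₂ := by
    have := hτκ t₁ κ₁ hκ₁
    rw [hvt₁, ← hvt₂, hτκ t₂ κ₂ hκ₂] at this
    exact (mul_right_cancel₀ hn0.ne' this).symm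
  have : t₁ = t₂ := hfi ⟨hs₁0.trans ht₁.1, ht₁.2.trans hs.2⟩ ⟨hs.1.trans ht₂.1, ht₂.2.trans hs₂1⟩
    (by rw [hκ₁, hκ₂, hκ])
  exact hne₁ (le_antisymm ht₁.2 (this ▸ ht₂.1))

/-! ### Extracting simple paths -/

lemma isSimplePath_image_Icc {f : ℝ → Plane} {a b : ℝ} (hab : a < b)
    (hf : Continuous f) (hinj : Set.InjOn f (Set.Icc a b)) :
    IsSimplePath (f '' Set.Icc a b) (f a) (f b) := by
  have hmem : ∀ t : unitInterval, a + t * (b - a) ∈ Set.Icc a b := fun t =>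
    ⟨by nlinarith [t.2.1], by nlinarith [t.2.2]⟩
  refine ⟨⟨⟨fun t => f (a + t * (b - a)), by fun_prop⟩, by simp, by simp⟩, ?_, ?_⟩
  · intro s t hst
    have := hinj (hmem s) (hmem t) hst
    exact Subtype.ext (mul_right_cancel₀ (sub_pos.2 hab).ne' (add_left_cancel this))
  · ext y
    constructor
    · rintro ⟨t, rfl⟩
      exact ⟨_, hmem t, rfl⟩
    · rintro ⟨t, ht, rfl⟩
      have hba := sub_pos.2 hab
      refine ⟨⟨(t - a) / (b - a), div_nonneg (by linarith [ht.1]) hba.le,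
        (div_le_one hba).2 (by linarith [ht.2])⟩, ?_⟩
      change f (a + (t - a) / (b - a) * (b - a)) = f t
      rw [div_mul_cancel₀ _ hba.ne']
      congr 1; ring

/-- `x` and `y` coincide or are joined by a simple path inside `S`. -/
def ArcJoined (S : Set Plane) (x y : Plane) : Prop :=
  x = y ∨ ∃ A ⊆ S, IsSimplePath A x y

/-- The path is cut at its first meeting with the segment and then continued straight to `v`. -/
lemma ArcJoined.append_segment {S : Set Plane} {c u v : Plane} (h : ArcJoined S c u)
    (hseg : segment ℝ u v ⊆ S) : ArcJoined S c v := by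
  by_cases hcv : c = v
  · exact Or.inl hcv
  have hline : ∀ w ∈ segment ℝ u v, ∀ t ∈ Set.Icc (0 : ℝ) 1,
      AffineMap.lineMap w v t ∈ segment ℝ u v := fun w hw t ht =>
    (convex_segment u v).segment_subset hw (right_mem_segment ℝ u v)
      (by rw [segment_eq_image_lineMap]; exact ⟨t, ht, rfl⟩)
  obtain ⟨f, hfc, hfi, hfS, hf0, hf1⟩ : ∃ f : ℝ → Plane, Continuous f ∧
      (c = u ∨ Set.InjOn f (Set.Icc 0 1)) ∧ (∀ t, f t ∈ S) ∧ f 0 = c ∧ f 1 = u := by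
    rcases h with rfl | ⟨A, hAS, γ, hinj, rfl⟩
    · exact ⟨fun _ => c, continuous_const, Or.inl rfl,
        fun _ => hseg (left_mem_segment ℝ c v), rfl, rfl⟩
    · refine ⟨γ.extend, γ.continuous_extend, Or.inr ?_, fun t => ?_, γ.extend_zero, γ.extend_one⟩
      · intro a ha b hb hab
        rw [Path.extend_apply γ ha, Path.extend_apply γ hb] at hab
        exact congrArg Subtype.val (hinj hab)
      · apply hAS
        rw [← Path.extend_range]; exact ⟨t, rfl⟩
  have hclosed : IsClosed (segment ℝ u v) := by
    rw [segment_eq_image_lineMap]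
    exact (isCompact_Icc.image AffineMap.lineMap_continuous).isClosed
  obtain ⟨t₀, ⟨ht₀, ht₀seg⟩, hmin⟩ :=
    (isCompact_Icc.inter_right (hclosed.preimage hfc)).exists_isLeast
      (⟨1, ⟨zero_le_one, le_rfl⟩, by simp [hf1, left_mem_segment]⟩ :
        (Set.Icc (0 : ℝ) 1 ∩ f ⁻¹' segment ℝ u v).Nonempty)
  have hinj₀ : Set.InjOn f (Set.Icc 0 t₀) := by
    rcases hfi with hcu | hfi
    · have : t₀ ≤ 0 := hmin ⟨⟨le_rfl, zero_le_one⟩, by simp [hf0, hcu, left_mem_segment]⟩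
      intro a ha b hb _
      linarith [ha.1, ha.2, hb.1, hb.2]
    · exact hfi.mono (Set.Icc_subset_Icc_right ht₀.2)
  by_cases hv : f t₀ = v
  · have hpos : 0 < t₀ := lt_of_le_of_ne ht₀.1 fun h => hcv (by rw [← hf0, h, hv])
    refine Or.inr ⟨f '' Set.Icc 0 t₀, ?_, ?_⟩
    · rintro _ ⟨t, -, rfl⟩; exact hfS t
    · have := isSimplePath_image_Icc hpos hfc hinj₀
      rwa [hf0, hv] at this
  · set g : ℝ → Plane := fun t =>
      if t ≤ t₀ then f t else AffineMap.lineMap (f t₀) v (t - t₀) with hg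
    have hgc : Continuous g := by
      refine Continuous.if_le hfc ?_ continuous_id continuous_const ?_
      · exact AffineMap.lineMap_continuous.comp (by fun_prop)
      · rintro t rfl; simp
    have hlt : (0 : ℝ) < t₀ + 1 := by linarith [ht₀.1]
    have hlinj := AffineMap.lineMap_injective ℝ hv
    have hmix : ∀ a ∈ Set.Icc 0 t₀, ∀ b ∈ Set.Ioc t₀ (t₀ + 1),
        f a ≠ AffineMap.lineMap (f t₀) v (b - t₀) := by
      intro a ha b hb hab
      have hmem : f a ∈ segment ℝ u v := by
        rw [hab]; exact hline _ ht₀seg _ ⟨by linarith [hb.1], by linarith [hb.2]⟩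
      have : t₀ ≤ a := hmin ⟨⟨ha.1, ha.2.trans ht₀.2⟩, hmem⟩
      obtain rfl : a = t₀ := le_antisymm ha.2 this
      have := hlinj ((AffineMap.lineMap_apply_zero (k := ℝ) (f a) v).trans hab)
      linarith [hb.1]
    have hginj : Set.InjOn g (Set.Icc 0 (t₀ + 1)) := by
      intro a ha b hb hab
      simp only [hg] at hab
      split_ifs at hab with h1 h2 h2
      · exact hinj₀ ⟨ha.1, h1⟩ ⟨hb.1, h2⟩ hab
      · exact absurd hab (hmix a ⟨ha.1, h1⟩ b ⟨not_le.1 h2, hb.2⟩)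
      · exact absurd hab.symm (hmix b ⟨hb.1, h2⟩ a ⟨not_le.1 h1, ha.2⟩)
      · linarith [hlinj hab]
    refine Or.inr ⟨g '' Set.Icc 0 (t₀ + 1), ?_, ?_⟩
    · rintro _ ⟨t, ht, rfl⟩
      simp only [hg]
      split_ifs with h
      · exact hfS t
      · exact hseg (hline _ ht₀seg _ ⟨by linarith, by linarith [ht.2]⟩)
    · have := isSimplePath_image_Icc hlt hgc hginj
      simpa [hg, ht₀.1, hf0, not_le.2 (zero_lt_one' ℝ)] using this

/-- In a locally star-shaped set, points joined by a path are joined by a simple path. -/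
lemma arcJoined_of_path {S : Set Plane} {c c' : Plane} (σ : unitInterval → Plane)
    (hσ : Continuous σ) (h0 : σ 0 = c) (h1 : σ 1 = c') (hS : ∀ t, σ t ∈ S)
    (hloc : ∀ x ∈ S, ∀ᶠ y in 𝓝 x, y ∈ S → segment ℝ x y ⊆ S) : ArcJoined S c c' := by
  have hev : ∀ t, ∀ᶠ t' in 𝓝 t, (ArcJoined S c (σ t) ↔ ArcJoined S c (σ t')) := by
    intro t
    filter_upwards [hσ.continuousAt.eventually (hloc (σ t) (hS t))] with t' ht'
    have hseg := ht' (hS t')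
    exact ⟨fun h => h.append_segment hseg,
      fun h => h.append_segment (by rwa [segment_symm])⟩
  have hclopen : IsClopen {t | ArcJoined S c (σ t)} := by
    constructor
    · rw [← isOpen_compl_iff, isOpen_iff_mem_nhds]
      intro t ht
      filter_upwards [hev t] with t' ht' h using ht (ht'.2 h)
    · rw [isOpen_iff_mem_nhds]
      intro t ht
      filter_upwards [hev t] with t' ht' using ht'.1 ht
  have := hclopen.eq_univ ⟨0, Or.inl h0.symm⟩
  have h1mem : (1 : unitInterval) ∈ {t | ArcJoined S c (σ t)} := this ▸ Set.mem_univ _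
  rw [← h1]
  exact h1mem

/-! ### Radial projection and existence -/

/-- Coordinate form of the inner product of `y - p` and `q - p`. -/
def dotAt (p y q : Plane) : ℝ := (y 0 - p 0) * (q 0 - p 0) + (y 1 - p 1) * (q 1 - p 1)

lemma dist_lt_dist_iff_dotAt {y w p : Plane} :
    dist y w < dist y p ↔ sqDist p w < 2 * dotAt p y w := by
  rw [dist_lt_dist_iff]
  unfold sqDist dotAt
  constructor <;> intro h <;> linarith

lemma dist_le_dist_iff_dotAt {y p s : Plane} :
    dist y p ≤ dist y s ↔ 2 * dotAt p y s ≤ sqDist p s := by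
  rw [← not_lt, dist_lt_dist_iff_dotAt, not_lt]

/-- Otherwise a half-plane would contain all sites, hence also `z`, and `y` could not be closer to
`z` than to `p`. -/
lemma exists_dotAt_pos {z p y : Plane} (hz : z ∈ convexHull ℝ P) (hp : p ∈ P)
    (hy : y ∈ openCell P z) : ∃ q ∈ P, 0 < dotAt p y q := by
  by_contra! hcon
  have hconv : Convex ℝ {w | dotAt p y w ≤ 0} := by
    intro a ha b hb s t hs ht hst
    obtain rfl : t = 1 - s := by linarith
    simp only [Set.mem_ofPred_eq, dotAt, PiLp.add_apply, PiLp.smul_apply, smul_eq_mul] at *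
    nlinarith [mul_le_mul_of_nonneg_left ha hs, mul_le_mul_of_nonneg_left hb ht]
  have h1 : dotAt p y z ≤ 0 := convexHull_min (fun q hq => hcon q hq) hconv hz
  have h2 := dist_lt_dist_iff_dotAt.1 (hy p hp)
  linarith [sqDist_nonneg p z]

/-- Pushing a point of the cell of `p` away from `p` until it meets the Voronoi diagram. -/
lemma exists_radial_projection (hP : P.Finite) {z p : Plane} (hz : z ∈ convexHull ℝ P)
    (hp : p ∈ P) (hq : ∃ q ∈ P, q ≠ p) :
    ∃ f : Plane → Plane, ContinuousOn f {y | IsNearest P y p ∧ y ∈ openCell P z} ∧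
      (∀ y, IsNearest P y p → y ∈ openCell P z →
        f y ∈ voronoiDiagram P ∧ ∀ w, y ∈ openCell P w → f y ∈ openCell P w) ∧
      ∀ y, IsNearest P y p → y ∈ voronoiDiagram P → f y = y := by
  classical
  obtain ⟨q₀, hq₀, hq₀p⟩ := hq
  have hne : (hP.toFinset.erase p).Nonempty := ⟨q₀, by simp [hq₀, hq₀p]⟩
  have hmem : ∀ q, q ∈ hP.toFinset.erase p ↔ q ≠ p ∧ q ∈ P := by simp
  -- When positive, `φ q y` is the reciprocal of the factor stretching `y - p` to the bisector of
  -- `p` and `q`. The maximum over `q` thus picks the first bisector reached.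
  set φ : Plane → Plane → ℝ := fun q y => 2 * dotAt p y q / sqDist p q with hφ
  set G : Plane → ℝ := (hP.toFinset.erase p).sup' hne φ with hGdef
  have hGc : Continuous G := Continuous.finset_sup' hne fun q _ => by
    simp only [hφ, dotAt]; fun_prop
  have hGle : ∀ y q, q ∈ P → q ≠ p → φ q y ≤ G y := by
    intro y q hq hqp
    rw [hGdef, Finset.sup'_apply]
    exact Finset.le_sup' (fun q => φ q y) ((hmem q).2 ⟨hqp, hq⟩)
  have hGex : ∀ y, ∃ q ∈ P, q ≠ p ∧ G y = φ q y := by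
    intro y
    obtain ⟨q, hq, h⟩ := Finset.exists_mem_eq_sup' hne (fun q => φ q y)
    rw [hmem] at hq
    exact ⟨q, hq.2, hq.1, by rw [hGdef, Finset.sup'_apply, h]⟩
  have hGpos : ∀ y ∈ openCell P z, 0 < G y := by
    intro y hy
    obtain ⟨q, hq, hd⟩ := exists_dotAt_pos hz hp hy
    have hqp : q ≠ p := by rintro rfl; simp [dotAt] at hd
    refine lt_of_lt_of_le ?_ (hGle y q hq hqp)
    have := sqDist_pos hqp.symm
    simp only [hφ]; positivity
  have hG1 : ∀ y, IsNearest P y p → G y ≤ 1 := by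
    intro y hy
    obtain ⟨q, hq, hqp, h⟩ := hGex y
    rw [h]
    exact (div_le_one (sqDist_pos hqp.symm)).2 (dist_le_dist_iff_dotAt.1 (hy.2 q hq))
  have hdot : ∀ y q (l : ℝ), dotAt p (p + l • (y - p)) q = l * dotAt p y q := by
    intro y q l
    simp [dotAt]; ring
  refine ⟨fun y => p + (G y)⁻¹ • (y - p), ?_, ?_, ?_⟩
  · refine continuousOn_const.add (ContinuousOn.smul (hGc.continuousOn.inv₀ ?_) (by fun_prop))
    rintro y ⟨-, hy⟩
    exact (hGpos y hy).ne'
  · intro y hyp hyz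
    have hg := hGpos y hyz
    have hnear : IsNearest P (p + (G y)⁻¹ • (y - p)) p := by
      refine ⟨hp, fun s hs => ?_⟩
      rcases eq_or_ne s p with rfl | hsp
      · exact le_rfl
      rw [dist_le_dist_iff_dotAt, hdot]
      have := hGle y s hs hsp
      simp only [hφ] at this
      rw [div_le_iff₀ (sqDist_pos hsp.symm)] at this
      rw [mul_left_comm, inv_mul_le_iff₀ hg]
      exact this
    refine ⟨?_, fun w hw s hs => ?_⟩
    · obtain ⟨q, hq, hqp, h⟩ := hGex y
      refine ⟨p, hp, q, hq, hqp.symm, ?_, hnear.2⟩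
      have h' : 2 * dotAt p y q = G y * sqDist p q := by
        rw [h]; simp only [hφ]; rw [div_mul_cancel₀ _ (sqDist_pos hqp.symm).ne']
      have heq : 2 * dotAt p (p + (G y)⁻¹ • (y - p)) q = sqDist p q := by
        rw [hdot, mul_left_comm, h', inv_mul_cancel_left₀ hg.ne']
      rw [dist_eq_dist_iff]
      unfold sqDist dotAt at *
      linarith
    · refine lt_of_lt_of_le ?_ (hnear.2 s hs)
      have h1 := dist_lt_dist_iff_dotAt.1 (hw p hp)
      rw [dist_lt_dist_iff_dotAt, hdot]
      have h2 : 1 ≤ (G y)⁻¹ := (one_le_inv₀ hg).2 (hG1 y hyp)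
      nlinarith [sqDist_nonneg p w]
  · intro y hyp hyV
    obtain ⟨q, hqn, hqp⟩ : ∃ q, IsNearest P y q ∧ q ≠ p := by
      obtain ⟨a, b, ha, hb, hab⟩ := mem_voronoiDiagram_iff.1 hyV
      by_cases h : a = p
      · exact ⟨b, hb, fun hb' => hab (h.trans hb'.symm)⟩
      · exact ⟨a, ha, h⟩
    have hφ1 : φ q y = 1 := by
      have := dist_eq_dist_iff.1 (hqn.dist_eq hyp)
      have hpos := sqDist_pos hqp.symm
      simp only [hφ]
      rw [div_eq_one_iff_eq hpos.ne']
      unfold sqDist dotAt at *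
      linarith
    have : G y = 1 := le_antisymm (hG1 y hyp) (hφ1 ▸ hGle y q hqn.1 hqp)
    simp [this]

lemma isClosed_setOf_isNearest (p : Plane) : IsClosed {y | IsNearest P y p} := by
  have : {y | IsNearest P y p} = {_y | p ∈ P} ∩ ⋂ s ∈ P, {y | dist y p ≤ dist y s} := by
    ext y; simp [IsNearest]
  rw [this]
  exact isClosed_const.inter
    (isClosed_biInter fun s _ => isClosed_le (by fun_prop) (by fun_prop))

/-- If `L` meets the convex hull of `P`, points of the Voronoi diagram whose maximal empty discs
contain `L` are joined by a path of such points. -/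
lemma exists_path_in_cells (hP : P.Finite) {L : Set Plane} {z c c' : Plane}
    (hzL : z ∈ L) (hz : z ∈ convexHull ℝ P) (hc : c ∈ voronoiDiagram P)
    (hc' : c' ∈ voronoiDiagram P) (hcL : ∀ w ∈ L, c ∈ openCell P w)
    (hcL' : ∀ w ∈ L, c' ∈ openCell P w) :
    ∃ σ : unitInterval → Plane, Continuous σ ∧ σ 0 = c ∧ σ 1 = c' ∧
      ∀ t, σ t ∈ voronoiDiagram P ∩ ⋂ w ∈ L, openCell P w := by
  obtain ⟨a, b, ha, hb, hab⟩ := mem_voronoiDiagram_iff.1 hc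
  have htwo : ∀ p : P, ∃ q ∈ P, q ≠ p := fun p => by
    by_cases h : a = p
    · exact ⟨b, hb.1, fun hb' => hab (h.trans hb'.symm)⟩
    · exact ⟨a, ha.1, h⟩
  choose f hfc hfV hfix using fun p : P => exists_radial_projection hP hz p.2 (htwo p)
  set y : unitInterval → Plane := fun t => AffineMap.lineMap c c' (t : ℝ) with hy
  have hyc : Continuous y := AffineMap.lineMap_continuous.comp continuous_subtype_val
  have hycell : ∀ t, ∀ w ∈ L, y t ∈ openCell P w := fun t w hw =>
    (convex_openCell w).segment_subset (hcL w hw) (hcL' w hw)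
      (by rw [segment_eq_image_lineMap]; exact ⟨t, t.2, rfl⟩)
  choose p hp using fun t => exists_isNearest hP ⟨a, ha.1⟩ (y t)
  set σ : unitInterval → Plane := fun t => f ⟨p t, (hp t).1⟩ (y t) with hσ
  have hσfix : ∀ t, y t ∈ voronoiDiagram P → σ t = y t := fun t ht => hfix _ _ (hp t) ht
  -- A point with several nearest sites is already on the diagram and fixed by all their
  -- projections, so these glue over the finite closed cover.
  have hσeq : ∀ (q : P) t, IsNearest P (y t) q → σ t = f q (y t) := by
    intro q t hq
    by_cases h : p t = q
    · simp only [hσ]; congr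
    · have hV := mem_voronoiDiagram_iff.2 ⟨p t, q, hp t, hq, h⟩
      rw [hσfix t hV, hfix q _ hq hV]
  have : Finite P := hP
  have hcont : Continuous σ := by
    refine LocallyFinite.continuous (f := fun q : P => {t | IsNearest P (y t) q})
      (locallyFinite_of_finite _) ?_ (fun q => (isClosed_setOf_isNearest _).preimage hyc) ?_
    · refine Set.eq_univ_of_forall fun t => Set.mem_iUnion.2 ⟨⟨p t, (hp t).1⟩, hp t⟩
    · intro q
      refine ContinuousOn.congr (f := fun t => f q (y t)) ?_ fun t ht => hσeq q t ht
      exact (hfc q).comp hyc.continuousOn fun t ht => ⟨ht, hycell t z hzL⟩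
  have hy0 : y 0 = c := by simp [hy]
  have hy1 : y 1 = c' := by simp [hy]
  refine ⟨σ, hcont, ?_, ?_, fun t => ?_⟩
  · rw [hσfix 0 (by rwa [hy0]), hy0]
  · rw [hσfix 1 (by rwa [hy1]), hy1]
  · obtain ⟨h1, h2⟩ := hfV ⟨p t, (hp t).1⟩ (y t) (hp t) (hycell t z hzL)
    exact ⟨h1, Set.mem_iInter₂.2 fun w hw => h2 w (hycell t w hw)⟩

lemma exists_simplePath_in_cells (hP : P.Finite) {L : Set Plane} {z c c' : Plane} (hcc' : c ≠ c')
    (hzL : z ∈ L) (hz : z ∈ convexHull ℝ P) (hc : c ∈ voronoiDiagram P)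
    (hc' : c' ∈ voronoiDiagram P) (hcL : ∀ w ∈ L, c ∈ openCell P w)
    (hcL' : ∀ w ∈ L, c' ∈ openCell P w) :
    ∃ A ⊆ voronoiDiagram P ∩ ⋂ w ∈ L, openCell P w, IsSimplePath A c c' := by
  obtain ⟨σ, hσ, h0, h1, hS⟩ := exists_path_in_cells hP hzL hz hc hc' hcL hcL'
  refine (arcJoined_of_path σ hσ h0 h1 hS fun x hx => ?_).resolve_left hcc'
  filter_upwards [eventually_isNearest hP x] with y hy hyS
  refine Set.subset_inter (segment_subset_voronoiDiagram hyS.1 hy) ?_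
  exact (convex_iInter₂ fun w _ => convex_openCell w).segment_subset hx.2 hyS.2

theorem mainTheorem7 (P : Set Plane) (hP : P.Finite) (c c' : Plane) (r r' : ℝ)
    (hC : IsMEC P c r) (hC' : IsMEC P c' r')
    (hne : Metric.ball c r ≠ Metric.ball c' r')
    (hoverlap : (Metric.ball c r ∩ Metric.ball c' r' ∩ convexHull ℝ P).Nonempty) :
    ∃! A : Set Plane, IsSimplePath A c c' ∧ A ⊆ voronoiDiagram P ∧
      ∀ x ∈ A, ∀ ρ : ℝ, IsMEC P x ρ →
        Metric.ball c r ∩ Metric.ball c' r' ⊆ Metric.ball x ρ := by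
  obtain ⟨z, hzL, hz⟩ := hoverlap
  obtain ⟨p, q, hp, hq, hpq, rfl⟩ := hC.exists_two_nearest hP
  obtain ⟨p', q', hp', hq', hpq', rfl⟩ := hC'.exists_two_nearest hP
  have hcc' : c ≠ c' := by
    rintro rfl
    exact hne (by rw [hp.dist_eq hp'])
  obtain ⟨A, hAS, hA⟩ := exists_simplePath_in_cells hP hcc' hzL hz
    (mem_voronoiDiagram_iff.2 ⟨p, q, hp, hq, hpq⟩)
    (mem_voronoiDiagram_iff.2 ⟨p', q', hp', hq', hpq'⟩)
    (fun w hw s hs => (Metric.mem_ball'.1 hw.1).trans_le (hp.2 s hs))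
    (fun w hw s hs => (Metric.mem_ball'.1 hw.2).trans_le (hp'.2 s hs))
  -- For uniqueness the single point `z` of the overlap suffices.
  have hcell : ∀ B : Set Plane, B ⊆ voronoiDiagram P →
      (∀ x ∈ B, ∀ ρ : ℝ, IsMEC P x ρ →
        Metric.ball c (dist c p) ∩ Metric.ball c' (dist c' p') ⊆ Metric.ball x ρ) →
      B ⊆ openCell P z := by
    intro B hBV hB x hx s hs
    obtain ⟨a, b, ha, hb, hab⟩ := mem_voronoiDiagram_iff.1 (hBV hx)
    have := hB x hx _ (isMEC_of_two_nearest ha hb hab) hzL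
    exact (Metric.mem_ball'.1 this).trans_le (ha.2 s hs)
  have hconn : ∀ B : Set Plane, IsSimplePath B c c' → IsPreconnected B ∧ c ∈ B ∧ c' ∈ B := by
    rintro _ ⟨γ, -, rfl⟩
    exact ⟨isPreconnected_range γ.continuous, ⟨0, γ.source⟩, ⟨1, γ.target⟩⟩
  have hAV : A ⊆ voronoiDiagram P := hAS.trans Set.inter_subset_left
  have hAL : ∀ x ∈ A, ∀ ρ : ℝ, IsMEC P x ρ →
      Metric.ball c (dist c p) ∩ Metric.ball c' (dist c' p') ⊆ Metric.ball x ρ := by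
    intro x hx ρ hρ w hw
    obtain ⟨a, b, ha, -, -, rfl⟩ := hρ.exists_two_nearest hP
    exact Metric.mem_ball'.2 (Set.mem_iInter₂.1 (hAS hx).2 w hw a ha.1)
  refine ⟨A, ⟨hA, hAV, hAL⟩, ?_⟩
  rintro B ⟨hB, hBV, hBL⟩
  have hAz := hcell A hAV hAL
  have hBz := hcell B hBV hBL
  obtain ⟨hA1, hA2, hA3⟩ := hconn A hA
  obtain ⟨hB1, hB2, hB3⟩ := hconn B hB
  exact Set.Subset.antisymm
    (hB.subset_of_isPreconnected hP hBV hBz hA1 hAV hAz hA2 hA3)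
    (hA.subset_of_isPreconnected hP hAV hAz hB1 hBV hBz hB2 hB3)
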